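/- Let $p\equiv 1\pmod 6$ be a prime, let $0<c_1<c_2<\cdots<c_{(p-1)/6}<p$ be all the sixth-power residues modulo $p$ in the interval $(0,p)$, and put $$Y_p=\det\left[\left(\frac{c_i+c_j}{p}\right)\right]_{1\le i,j\le (p-1)/6},$$ where $\left(\frac{\cdot}{p}\right)$ is the Legendre symbol. Let $x_3,y_3$ be integers with $p=x_3^2+3y_3^2$ and $x_3\equiv 1\pmod 3$. (i) If $p\equiv 7\pmod{12}$, then $-3Y_p/(1+2x_3)$ is the square of an integer. (ii) If $p\equiv 1\pmod{12}$, and $x_4,y_4$ are integers with $p=x_4^2+4y_4^2$ and $x_4\equiv\left(\frac{2}{p}\right)\pmod 4$, then $$(-1)^{\frac{p+3}{4}}\,3Y_p=(1+2x_3)\,x_4\,\delta_p\,z_p^2$$ for some integer $z_p$, where $\delta_p=1/3$ if $3\mid x_4$ and $\delta_p=-1$ if $3\nmid x_4$. -/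

import Mathlib

/-- The `6`-th power residues modulo `p` in the open interval `(0, p)`. -/
noncomputable def sixthPowerResidues (p : ℕ) : Finset ℕ :=
  open Classical in (Finset.Ioo 0 p).filter fun c => ∃ x : ℤ, x ^ 6 ≡ (c : ℤ) [ZMOD (p : ℤ)]

/-- The increasing enumeration `c_1 < c_2 < ⋯` of the `6`-th power residues modulo `p`
in `(0, p)` (indexed from `0`). -/
noncomputable def sixthPowerResidue (p : ℕ) (i : Fin (sixthPowerResidues p).card) : ℕ :=
  (sixthPowerResidues p).orderEmbOfFin rfl i

/-- The determinant `Y_p` of the matrix of Legendre symbols `((c_i + c_j) / p)`. -/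
noncomputable def Y (p : ℕ) [Fact p.Prime] : ℤ :=
  Matrix.det (Matrix.of fun i j : Fin (sixthPowerResidues p).card =>
    legendreSym p ((sixthPowerResidue p i : ℤ) + (sixthPowerResidue p j : ℤ)))

/-- The rational number `δ_p`, as a function of `x₄`. -/
def deltaSix (x₄ : ℤ) : ℚ := if (3 : ℤ) ∣ x₄ then 1 / 3 else -1

/-! Let `g` generate the units modulo `p` and let χ be the quadratic character. Sixth-power residues
are the `g ^ (6 * i)` with `i` in `ZMod n`, `n = (p - 1) / 6`. Pulling out the square `g ^ (6 * j)`
turns the `(i, j)` entry into χ(1 + g^(6(i - j))), so the matrix is a symmetric circulant. Its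
eigenvalues satisfy λ_r = λ_(-r), and pairing them makes the determinant λ_0 (times λ_(n/2) if `n`
is even) times a square. The root of that square is a Galois-invariant algebraic integer, hence an
integer (`Matrix.exists_det_circulant_even`).

The two surviving eigenvalues come from Jacobi sums of χ. A cubic one, of norm `p`, gives 3λ_0 = -(1
+ 2x₃) (`three_mul_sum_shiftedChar_six_mul`). For p = 12k + 1, the number 3λ_(n/2) is a + 2c, where
a + bi and c + di are the sums attached to characters of order 4 and 12. Both have norm `p`, so c =
±a = ±x₄; congruences modulo 3 and 4 and a reduction modulo a prime above `p` fix the signs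
(`classSum_zero_sub_six_eq`). -/

/-! ### Even functions on `ZMod n` and determinants of symmetric circulants. -/

open Finset in
/-- A product over `ZMod n` of an even function is the product of its values at the points fixed
by negation, times a square. -/
theorem ZMod.prod_even {K : Type*} [CommRing K] (n : ℕ) [NeZero n] (F : ZMod n → K)
    (hF : ∀ r, F (-r) = F r) :
    ∏ r, F r = F 0 * (if Even n then F ((n / 2 : ℕ) : ZMod n) else 1) *
      (∏ r ∈ range n with 0 < r ∧ 2 * r < n, F (r : ZMod n)) ^ 2 := by
  have h1 : ∏ r, F r = ∏ r ∈ range n, F (r : ZMod n) := by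
    refine Finset.prod_nbij' (fun r => r.val) (fun r => (r : ZMod n)) ?_ ?_ ?_ ?_ ?_
    · intro a _; simpa using ZMod.val_lt a
    · simp
    · simp
    · intro a ha; exact ZMod.val_natCast_of_lt (by simpa using ha)
    · simp
  have hG : ∀ r ≤ n, F ((n - r : ℕ) : ZMod n) = F (r : ZMod n) := by
    intro r hr
    rw [Nat.cast_sub hr, ZMod.natCast_self, zero_sub, hF]
  have hr : ∏ r ∈ range n with n < 2 * r, F (r : ZMod n) =
      ∏ r ∈ range n with 0 < r ∧ 2 * r < n, F (r : ZMod n) := by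
    refine Finset.prod_nbij' (fun r => n - r) (fun r => n - r) ?_ ?_ ?_ ?_ ?_
    · intro a ha; simp only [mem_filter, mem_range] at ha ⊢; omega
    · intro a ha; simp only [mem_filter, mem_range] at ha ⊢; omega
    · intro a ha; simp only [mem_filter, mem_range] at ha ⊢; omega
    · intro a ha; simp only [mem_filter, mem_range] at ha ⊢; omega
    · intro a ha; simp only [mem_filter, mem_range] at ha; exact (hG a (by omega)).symm
  have hpos : 0 < n := NeZero.pos n
  rw [h1, ← prod_filter_mul_prod_filter_not (range n) (fun r => n < 2 * r), hr,
    ← prod_filter_mul_prod_filter_not ((range n).filter fun r => ¬ n < 2 * r)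
      (fun r => 0 < r ∧ 2 * r < n), filter_filter, filter_filter]
  have h2 : (range n).filter (fun r => ¬ n < 2 * r ∧ (0 < r ∧ 2 * r < n)) =
      (range n).filter (fun r => 0 < r ∧ 2 * r < n) := by
    ext r; simp only [mem_filter, mem_range]; omega
  have h3 : ∏ r ∈ (range n).filter (fun r => ¬ n < 2 * r ∧ ¬ (0 < r ∧ 2 * r < n)),
      F (r : ZMod n) = F 0 * (if Even n then F ((n / 2 : ℕ) : ZMod n) else 1) := by
    split_ifs with he
    · obtain ⟨m, rfl⟩ := he
      have : (range (m + m)).filter (fun r => ¬ m + m < 2 * r ∧ ¬ (0 < r ∧ 2 * r < m + m)) =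
          {0, (m + m) / 2} := by
        ext r; simp only [mem_filter, mem_range, mem_insert, mem_singleton]; omega
      rw [this, prod_pair (by omega), Nat.cast_zero]
    · have : (range n).filter (fun r => ¬ n < 2 * r ∧ ¬ (0 < r ∧ 2 * r < n)) = {0} := by
        ext r; simp only [mem_filter, mem_range, mem_singleton]
        rw [Nat.even_iff] at he; omega
      rw [this, prod_singleton, Nat.cast_zero, mul_one]
  rw [h2, h3]; ring

open Finset in
/-- Multiplication by a unit permutes the classes of `ZMod n` modulo negation. -/
theorem ZMod.prod_half_unit_mul {K : Type*} [CommRing K] (n : ℕ) [NeZero n] (F : ZMod n → K)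
    (hF : ∀ r, F (-r) = F r) (u : (ZMod n)ˣ) :
    ∏ r ∈ range n with 0 < r ∧ 2 * r < n, F ((u : ZMod n) * (r : ZMod n)) =
      ∏ r ∈ range n with 0 < r ∧ 2 * r < n, F (r : ZMod n) := by
  have hpos : 0 < n := NeZero.pos n
  set H := (range n).filter fun r => 0 < r ∧ 2 * r < n with hH
  -- The representative of ±ur in [0, n/2]; it is shown to permute `H`.
  let φ : ℕ → ℕ := fun r => ((u : ZMod n) * (r : ZMod n)).valMinAbs.natAbs
  have hφ : ∀ r, ((φ r : ℕ) : ZMod n) = u * r ∨ ((φ r : ℕ) : ZMod n) = -(u * r) := by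
    intro r
    rcases Int.natAbs_eq ((u : ZMod n) * (r : ZMod n)).valMinAbs with h | h
    · left
      conv_rhs => rw [← ZMod.coe_valMinAbs ((u : ZMod n) * (r : ZMod n)), h]
      simp [φ]
    · right
      conv_rhs => rw [← ZMod.coe_valMinAbs ((u : ZMod n) * (r : ZMod n)), h]
      simp [φ]
  have hinj : ∀ r s : ℕ, 2 * r < n → 2 * s < n →
      ((r : ZMod n) = s ∨ (r : ZMod n) = -s) → r = s := by
    intro r s hr hs h
    rcases h with h | h
    · rw [ZMod.natCast_eq_natCast_iff'] at h
      rwa [Nat.mod_eq_of_lt (by omega), Nat.mod_eq_of_lt (by omega)] at h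
    · have : ((r + s : ℕ) : ZMod n) = 0 := by push_cast; rw [h]; ring
      rw [ZMod.natCast_eq_zero_iff] at this
      have := Nat.eq_zero_of_dvd_of_lt this (by omega)
      omega
  have hmaps : ∀ r ∈ H, φ r ∈ H := by
    intro r hr
    simp only [hH, mem_filter, mem_range] at hr ⊢
    have hle : φ r ≤ n / 2 := ZMod.natAbs_valMinAbs_le _
    have h0 : φ r ≠ 0 := by
      intro h0
      have : (u : ZMod n) * (r : ZMod n) = 0 := by
        rcases hφ r with h | h <;> rw [h0] at h
        · simpa using h.symm
        · simpa using h.symm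
      rw [Units.mul_right_eq_zero, ZMod.natCast_eq_zero_iff] at this
      have := Nat.eq_zero_of_dvd_of_lt this (by omega)
      omega
    have h1 : 2 * φ r ≠ n := by
      intro h1
      have h2 : (2 : ZMod n) * (φ r : ℕ) = 0 := by
        have : ((2 * φ r : ℕ) : ZMod n) = 0 := by rw [h1]; simp
        simpa using this
      have : (u : ZMod n) * ((2 * r : ℕ) : ZMod n) = 0 := by
        push_cast
        rcases hφ r with h | h <;> rw [h] at h2
        · linear_combination h2
        · linear_combination -h2
      rw [Units.mul_right_eq_zero, ZMod.natCast_eq_zero_iff] at this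
      have := Nat.eq_zero_of_dvd_of_lt this (by omega)
      omega
    omega
  have hφinj : Set.InjOn φ H := by
    intro r hr s hs h
    simp only [hH, coe_filter, mem_range, Set.mem_ofPred_eq] at hr hs
    apply hinj r s hr.2.2 hs.2.2
    have hu : ∀ a b : ZMod n, (u : ZMod n) * a = u * b → a = b := fun a b => u.isUnit.mul_left_cancel
    rcases hφ r with h1 | h1 <;> rcases hφ s with h2 | h2 <;> rw [h, h2] at h1
    · exact Or.inl (hu _ _ h1.symm)
    · exact Or.inr (hu _ _ (by linear_combination -h1))
    · exact Or.inr (hu _ _ (by linear_combination h1))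
    · exact Or.inl (hu _ _ (by linear_combination h1))
  have himg : H.image φ = H := by
    apply eq_of_subset_of_card_le
    · intro x hx
      obtain ⟨r, hr, rfl⟩ := mem_image.mp hx
      exact hmaps r hr
    · rw [card_image_of_injOn hφinj]
  conv_rhs => rw [← himg]
  rw [prod_image hφinj]
  refine prod_congr rfl fun r _ => ?_
  rcases hφ r with h | h <;> rw [h]
  rw [hF]

open Finset in
/-- Fourier diagonalization of circulant matrices. -/
theorem Matrix.det_circulant_eq_prod {K : Type*} [Field K] [CharZero K] (n : ℕ) [NeZero n]
    (e : AddChar (ZMod n) K) (he : e.IsPrimitive) (f : ZMod n → K) :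
    (Matrix.of fun i j => f (i - j)).det = ∏ r, ∑ k, f k * e (-(k * r)) := by
  set M : Matrix (ZMod n) (ZMod n) K := Matrix.of fun i j => f (i - j)
  let V : Matrix (ZMod n) (ZMod n) K := Matrix.of fun i j => e (i * j)
  let W : Matrix (ZMod n) (ZMod n) K := Matrix.of fun i j => e (-(i * j))
  -- The columns of `V`, the additive characters, are eigenvectors of `M`.
  have hMV : M * V = V * Matrix.diagonal fun r => ∑ k, f k * e (-(k * r)) := by
    ext i r
    rw [Matrix.mul_diagonal, Matrix.mul_apply, mul_sum, ← Equiv.sum_comp (Equiv.subLeft i)]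
    refine sum_congr rfl fun k _ => ?_
    simp only [M, V, Matrix.of_apply, Equiv.subLeft_apply, sub_sub_cancel]
    rw [mul_left_comm, ← AddChar.map_add_eq_mul]
    congr 2; ring
  have hVW : V * W = (n : K) • (1 : Matrix (ZMod n) (ZMod n) K) := by
    ext i j
    rw [Matrix.mul_apply]
    have : ∀ k, V i k * W k j = e (k * (i - j)) := by
      intro k
      simp only [V, W, Matrix.of_apply, ← AddChar.map_add_eq_mul]
      congr 1; ring
    simp only [this]
    rw [AddChar.sum_mulShift _ he, Matrix.smul_apply, Matrix.one_apply]
    simp [sub_eq_zero]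
  have hV : V.det ≠ 0 := by
    intro h
    have h2 := congrArg Matrix.det hVW
    rw [Matrix.det_mul, h, zero_mul, Matrix.det_smul, Matrix.det_one, mul_one] at h2
    exact pow_ne_zero _ (Nat.cast_ne_zero.mpr (NeZero.ne n)) h2.symm
  have h := congrArg Matrix.det hMV
  rw [Matrix.det_mul, Matrix.det_mul, Matrix.det_diagonal, mul_comm] at h
  exact mul_left_cancel₀ hV h

-- The eigenvalues off the fixed points of negation come in equal pairs, so their product is `P ^
-- 2`. A Galois automorphism ζ ↦ ζ^i sends the eigenvalue at r to the one at ir, hence only permutes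
-- the factors of `P` up to r ↦ -r. Thus `P` is rational and integral.
open Finset in
theorem Matrix.exists_det_circulant_even_of_isCyclotomicExtension (K : Type*) [Field K]
    [CharZero K] [Algebra ℚ K] (n : ℕ) [NeZero n] [IsCyclotomicExtension {n} ℚ K] (f : ZMod n → ℤ)
    (hf : ∀ k, f (-k) = f k) :
    ∃ z : ℤ, (Matrix.of fun i j => f (i - j)).det =
      (∑ k, f k) * (if Even n then ∑ k, f k * (-1) ^ k.val else 1) * z ^ 2 := by
  have hζ : IsPrimitiveRoot (IsCyclotomicExtension.zeta n ℚ K) n :=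
    IsCyclotomicExtension.zeta_spec n ℚ K
  set ζ := IsCyclotomicExtension.zeta n ℚ K
  have : IsGalois ℚ K := IsCyclotomicExtension.isGalois {n} ℚ K
  have : FiniteDimensional ℚ K := IsCyclotomicExtension.finiteDimensional {n} ℚ K
  let e : AddChar (ZMod n) K := AddChar.zmodChar n hζ.pow_eq_one
  have he : e.IsPrimitive := AddChar.zmodChar_primitive_of_primitive_root n hζ
  let F : ZMod n → K := fun r => ∑ k, (f k : K) * e (-(k * r))
  have hF : ∀ r, F (-r) = F r := by
    intro r
    simp only [F]
    rw [← Equiv.sum_comp (Equiv.neg (ZMod n))]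
    simp [hf]
  have hdet := Matrix.det_circulant_eq_prod n e he (fun k => (f k : K))
  rw [ZMod.prod_even n F hF] at hdet
  set P := ∏ r ∈ range n with 0 < r ∧ 2 * r < n, F (r : ZMod n) with hP
  have hint : IsIntegral ℤ P := by
    refine IsIntegral.prod _ fun r _ => IsIntegral.sum _ fun k _ => IsIntegral.mul ?_ ?_
    · exact isIntegral_algebraMap (x := f k)
    · exact (hζ.isIntegral (NeZero.pos n)).pow _
  have hfix : ∀ σ : Gal(K/ℚ), σ P = P := by
    intro σ
    have hσ : IsPrimitiveRoot (σ ζ) n := hζ.map_of_injective σ.injective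
    obtain ⟨i, hi, hiσ⟩ := hζ.eq_pow_of_pow_eq_one hσ.pow_eq_one
    have hcop : i.Coprime n := by
      rw [← hiσ] at hσ
      exact (hζ.pow_iff_coprime (NeZero.pos n) i).mp hσ
    have hσe : ∀ x, σ (e x) = e (i * x) := by
      intro x
      conv_rhs => rw [← ZMod.natCast_zmod_val x, ← Nat.cast_mul]
      simp only [e, AddChar.zmodChar_apply']
      rw [AddChar.zmodChar_apply, map_pow, ← hiσ, pow_mul]
    have hσF : ∀ r, σ (F r) = F (ZMod.unitOfCoprime i hcop * r) := by
      intro r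
      simp only [F, map_sum, map_mul, hσe, map_intCast, ZMod.coe_unitOfCoprime]
      refine sum_congr rfl fun k _ => ?_
      congr 2; ring
    rw [hP, map_prod]
    simp only [hσF]
    exact ZMod.prod_half_unit_mul n F hF _
  obtain ⟨q, hq⟩ := (IsGalois.mem_range_algebraMap_iff_fixed P).mpr hfix
  have hqi : IsIntegral ℤ q := by
    rw [← hq] at hint
    exact (isIntegral_algebraMap_iff (algebraMap ℚ K).injective).mp hint
  obtain ⟨z, hz⟩ := IsIntegrallyClosed.isIntegral_iff.mp hqi
  have hzP : (z : K) = P := by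
    rw [← hq, ← hz]; simp
  refine ⟨z, ?_⟩
  have h0 : F 0 = ((∑ k, f k : ℤ) : K) := by simp [F]
  have h1 : (if Even n then F ((n / 2 : ℕ) : ZMod n) else 1) =
      ((if Even n then ∑ k, f k * (-1) ^ k.val else 1 : ℤ) : K) := by
    split_ifs with hn
    -- Passing to -n/2 cancels the minus sign in `e (-(k * r))`.
    · rw [← hF]
      obtain ⟨m, hm⟩ := hn
      have hm0 : m ≠ 0 := by have := NeZero.ne n; omega
      have hζm : ζ ^ m = -1 := by
        have h : IsPrimitiveRoot (ζ ^ m) 2 := hζ.pow (NeZero.pos n) (by omega)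
        exact h.eq_neg_one_of_two_right
      simp only [F, Int.cast_sum]
      refine sum_congr rfl fun k _ => ?_
      have : -(k * -((n / 2 : ℕ) : ZMod n)) = ((m * k.val : ℕ) : ZMod n) := by
        rw [show n / 2 = m by omega]; push_cast
        rw [ZMod.natCast_zmod_val]; ring
      rw [this]
      simp only [e, AddChar.zmodChar_apply', pow_mul, hζm]
      push_cast; rfl
    · simp
  rw [h0, h1, ← hzP] at hdet
  apply Int.cast_injective (α := K)
  rw [Int.cast_det]
  push_cast at hdet ⊢
  rw [← hdet]
  rfl

/-- The determinant of a symmetric integral circulant matrix, up to a square factor. -/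
theorem Matrix.exists_det_circulant_even (n : ℕ) [NeZero n] (f : ZMod n → ℤ)
    (hf : ∀ k, f (-k) = f k) :
    ∃ z : ℤ, (Matrix.of fun i j => f (i - j)).det =
      (∑ k, f k) * (if Even n then ∑ k, f k * (-1) ^ k.val else 1) * z ^ 2 := by
  have : NeZero (n : ℚ) := ⟨Nat.cast_ne_zero.mpr (NeZero.ne n)⟩
  have h := CyclotomicField.isCyclotomicExtension n ℚ
  exact @Matrix.exists_det_circulant_even_of_isCyclotomicExtension (CyclotomicField n ℚ) _ _
    (CyclotomicField.algebra n ℚ) n _ h f hf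

/-! ### Values χ(1 + g^k) and the Jacobi sums they generate. -/

/-- The quadratic character of `ZMod p` at `1 + g ^ k`. -/
def shiftedChar {p : ℕ} [Fact p.Prime] (g : (ZMod p)ˣ) (k : ℕ) : ℤ :=
  quadraticChar (ZMod p) (1 + (g : ZMod p) ^ k)

section Generator

variable {p : ℕ} [Fact p.Prime] {g : (ZMod p)ˣ}

theorem quadraticChar_generator (hp : p ≠ 2) (hg : orderOf g = p - 1) :
    quadraticChar (ZMod p) (g : ZMod p) = -1 := by
  have hp2 := (Fact.out : p.Prime).two_le
  rcases quadraticChar_dichotomy g.ne_zero with h | h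
  · exfalso
    have h1 := quadraticChar_eq_pow_of_char_ne_two' (F := ZMod p)
      (by rwa [ZMod.ringChar_zmod_n]) (g : ZMod p)
    rw [h, ZMod.card, Int.cast_one, ← Units.val_pow_eq_pow_val] at h1
    have h2 : g ^ (p / 2) = 1 := Units.ext h1.symm
    have h3 := orderOf_dvd_of_pow_eq_one h2
    rw [hg] at h3
    have := Nat.le_of_dvd (by omega) h3
    omega
  · exact h

theorem ZMod.exists_units_orderOf (p : ℕ) [Fact p.Prime] : ∃ g : (ZMod p)ˣ, orderOf g = p - 1 := by
  obtain ⟨g, hg⟩ := IsCyclic.exists_generator (α := (ZMod p)ˣ)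
  exact ⟨g, by rw [orderOf_eq_card_of_forall_mem_zpowers hg, Nat.card_eq_fintype_card,
    ZMod.card_units]⟩

theorem quadraticChar_generator_pow (hp : p ≠ 2) (hg : orderOf g = p - 1) (k : ℕ) :
    quadraticChar (ZMod p) ((g : ZMod p) ^ k) = (-1) ^ k := by
  rw [map_pow, quadraticChar_generator hp hg]

theorem generator_pow_card_sub_one (g : (ZMod p)ˣ) : (g : ZMod p) ^ (p - 1) = 1 := by
  rw [← Units.val_pow_eq_pow_val, ZMod.units_pow_card_sub_one_eq_one, Units.val_one]

theorem generator_pow_half (hp : p ≠ 2) (hg : orderOf g = p - 1) :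
    (g : ZMod p) ^ (p / 2) = -1 := by
  have h1 := quadraticChar_eq_pow_of_char_ne_two' (F := ZMod p)
      (by rwa [ZMod.ringChar_zmod_n]) (g : ZMod p)
  rw [quadraticChar_generator hp hg, ZMod.card] at h1
  rw [← h1]; simp

theorem generator_pow_injOn (hg : orderOf g = p - 1) :
    Set.InjOn (fun k : ℕ => (g : ZMod p) ^ k) (Set.Iio (p - 1)) := by
  intro a ha b hb h
  have h' : g ^ a = g ^ b := Units.ext (by simpa using h)
  rw [← hg] at ha hb
  exact pow_injOn_Iio_orderOf ha hb h'

theorem sum_units_eq_sum_range {M : Type*} [AddCommMonoid M] (hg : orderOf g = p - 1)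
    (F : (ZMod p)ˣ → M) : ∑ u, F u = ∑ k ∈ Finset.range (p - 1), F (g ^ k) := by
  have hinj : Set.InjOn (fun k : ℕ => g ^ k) (Finset.range (p - 1) : Set ℕ) := by
    rw [Finset.coe_range, ← hg]; exact pow_injOn_Iio_orderOf
  have himg : (Finset.range (p - 1)).image (fun k => g ^ k) = Finset.univ := by
    apply Finset.eq_univ_of_card
    rw [Finset.card_image_of_injOn hinj, Finset.card_range, ZMod.card_units]
  rw [← himg, Finset.sum_image hinj]

theorem sum_eq_add_sum_units {M : Type*} [AddCommMonoid M] (F : ZMod p → M) :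
    ∑ x, F x = F 0 + ∑ u : (ZMod p)ˣ, F u := by
  classical
  rw [← Finset.add_sum_erase _ _ (Finset.mem_univ (0 : ZMod p))]
  congr 1
  refine Finset.sum_bij' (fun x hx => Units.mk0 x (Finset.ne_of_mem_erase hx)) (fun u _ => u)
    ?_ ?_ ?_ ?_ ?_ <;> simp

theorem sum_eq_add_sum_range {M : Type*} [AddCommMonoid M] (hg : orderOf g = p - 1)
    (F : ZMod p → M) : ∑ x, F x = F 0 + ∑ k ∈ Finset.range (p - 1), F ((g : ZMod p) ^ k) := by
  rw [sum_eq_add_sum_units, sum_units_eq_sum_range hg]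
  simp

/-- From 1 + u = u(1 + u⁻¹) with u = g^k, and χ(g) = -1. All later symmetries come from this. -/
theorem shiftedChar_card_sub_one_sub (hp : p ≠ 2) (hg : orderOf g = p - 1) {k : ℕ}
    (hk : k ≤ p - 1) : shiftedChar g (p - 1 - k) = (-1) ^ k * shiftedChar g k := by
  have h1 : (g : ZMod p) ^ (p - 1 - k) * (g : ZMod p) ^ k = 1 := by
    rw [← pow_add, Nat.sub_add_cancel hk, generator_pow_card_sub_one]
  have h2 : (1 + (g : ZMod p) ^ k) = g ^ k * (1 + (g : ZMod p) ^ (p - 1 - k)) := by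
    linear_combination -h1
  rw [shiftedChar, shiftedChar, h2, map_mul, quadraticChar_generator_pow hp hg, ← mul_assoc,
    ← mul_pow]
  simp

theorem shiftedChar_half (hp : p ≠ 2) (hg : orderOf g = p - 1) :
    shiftedChar g (p / 2) = 0 := by
  rw [shiftedChar, generator_pow_half hp hg]; simp

theorem odd_shiftedChar (hp : p ≠ 2) (hg : orderOf g = p - 1) {k : ℕ} (hk : k < p - 1)
    (hk' : k ≠ p / 2) : Odd (shiftedChar g k) := by
  have h0 : 1 + (g : ZMod p) ^ k ≠ 0 := by
    intro h
    have hp2 := (Fact.out : p.Prime).two_le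
    apply hk'
    apply generator_pow_injOn hg hk (by simp only [Set.mem_Iio]; omega)
    simp only
    rw [generator_pow_half hp hg]
    linear_combination h
  rcases quadraticChar_dichotomy h0 with h | h <;> rw [shiftedChar, h]
  · exact odd_one
  · exact ⟨-1, by norm_num⟩

theorem sum_shiftedChar (hp : p ≠ 2) (hg : orderOf g = p - 1) :
    ∑ k ∈ Finset.range (p - 1), shiftedChar g k = -1 := by
  have h := quadraticChar_sum_zero (F := ZMod p) (by rwa [ZMod.ringChar_zmod_n])
  rw [← Equiv.sum_comp (Equiv.addLeft (1 : ZMod p)), sum_eq_add_sum_range hg] at h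
  simp only [Equiv.coe_addLeft, add_zero, map_one] at h
  simp only [shiftedChar]
  linear_combination h

/-- Substitute x ↦ -x in Σ κ(x)χ(1 - x), then write x = g^k. -/
theorem jacobiSum_quadraticChar_eq (hg : orderOf g = p - 1)
    (κ : MulChar (ZMod p) ℂ) :
    jacobiSum ((quadraticChar (ZMod p)).ringHomComp (Int.castRingHom ℂ)) κ =
      κ (-1) * ∑ k ∈ Finset.range (p - 1), (shiftedChar g k : ℂ) * κ g ^ k := by
  rw [jacobiSum_comm, jacobiSum, ← Equiv.sum_comp (Equiv.neg (ZMod p)), sum_eq_add_sum_range hg]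
  simp only [Equiv.neg_apply, neg_zero, sub_neg_eq_add, MulChar.ringHomComp_apply]
  rw [MulChar.map_zero, zero_mul, zero_add, Finset.mul_sum]
  refine Finset.sum_congr rfl fun k _ => ?_
  rw [neg_eq_neg_one_mul, map_mul, map_pow, shiftedChar, eq_intCast]
  ring

/-- The quadratic Jacobi sums have absolute value `√p`. -/
theorem sum_shiftedChar_mul_pow_mul (hp : p ≠ 2) (hg : orderOf g = p - 1) (ζ : ℂ)
    (hζ : ζ ^ (p - 1) = 1) (hζ2 : ζ ^ 2 ≠ 1) :
    (∑ k ∈ Finset.range (p - 1), (shiftedChar g k : ℂ) * ζ ^ k) *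
      (∑ k ∈ Finset.range (p - 1), (shiftedChar g k : ℂ) * ζ⁻¹ ^ k) = p := by
  have hp2 := (Fact.out : p.Prime).two_le
  have hζ0 : ζ ≠ 0 := by
    rintro rfl
    rw [zero_pow (by omega)] at hζ
    exact zero_ne_one hζ
  have hgen : ∀ x, x ∈ Subgroup.zpowers g := by
    intro x
    have : Subgroup.zpowers g = ⊤ := by
      apply Subgroup.eq_top_of_card_eq
      rw [Nat.card_zpowers, hg, Nat.card_eq_fintype_card, ZMod.card_units]
    rw [this]; trivial
  have hmem : Units.mk0 ζ hζ0 ∈ rootsOfUnity (Fintype.card (ZMod p)ˣ) ℂ := by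
    rw [mem_rootsOfUnity, ZMod.card_units]
    exact Units.ext (by simpa using hζ)
  set κ : MulChar (ZMod p) ℂ := MulChar.ofRootOfUnity hmem hgen
  have hκ : κ g = ζ := MulChar.ofRootOfUnity_spec hmem hgen
  set χ := (quadraticChar (ZMod p)).ringHomComp (Int.castRingHom ℂ) with hχ
  have hχg : χ g = -1 := by
    rw [hχ, MulChar.ringHomComp_apply, quadraticChar_generator hp hg]; simp
  have hχinv : χ⁻¹ = χ := ((quadraticChar_isQuadratic (ZMod p)).comp _).inv
  have hκinv : κ⁻¹ g = ζ⁻¹ := by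
    rw [MulChar.inv_apply_eq_inv', hκ]
  have h := jacobiSum_mul_jacobiSum_inv (F := ZMod p) (F' := ℂ) (χ := χ) (φ := κ)
    (by rw [ZMod.ringChar_zmod_n, ringChar.eq_zero]; omega)
    (by intro h; rw [h, MulChar.one_apply_coe] at hχg; norm_num at hχg)
    (by intro h; rw [h, MulChar.one_apply_coe] at hκ; rw [← hκ] at hζ2; norm_num at hζ2)
    (by
      intro h
      have h1 : (χ * κ) g = 1 := by rw [h, MulChar.one_apply_coe]
      rw [MulChar.mul_apply, hχg, hκ] at h1
      apply hζ2
      linear_combination (1 - ζ) * h1)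
  rw [hχinv, jacobiSum_quadraticChar_eq hg, jacobiSum_quadraticChar_eq hg, hκ, hκinv,
    ZMod.card] at h
  have h1 : κ (-1) * κ⁻¹ (-1) = 1 := by
    rw [← MulChar.mul_apply, mul_inv_cancel]
    exact MulChar.one_apply (by simp)
  rw [← h]
  linear_combination (-(∑ k ∈ Finset.range (p - 1), (shiftedChar g k : ℂ) * ζ ^ k) *
      (∑ k ∈ Finset.range (p - 1), (shiftedChar g k : ℂ) * ζ⁻¹ ^ k)) * h1

/-- Reduction modulo `p` of the quadratic Jacobi sums of small weight. -/
theorem sum_shiftedChar_mul_pow_eq_zero (hp : p ≠ 2) (hg : orderOf g = p - 1) {t : ℕ}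
    (ht : 0 < t) (htp : t + p / 2 < p - 1) :
    ∑ k ∈ Finset.range (p - 1), (shiftedChar g k : ZMod p) * ((g : ZMod p) ^ t) ^ k = 0 := by
  -- By Euler's criterion the sum becomes Σ (1 + x)^(p/2) x^t over the field. All exponents are
  -- below p - 1, so every power sum vanishes; t > 0 kills the term at x = 0.
  have h1 : ∀ k, (shiftedChar g k : ZMod p) * ((g : ZMod p) ^ t) ^ k =
      (1 + (g : ZMod p) ^ k) ^ (p / 2) * ((g : ZMod p) ^ k) ^ t := by
    intro k
    rw [shiftedChar, quadraticChar_eq_pow_of_char_ne_two' (by rwa [ZMod.ringChar_zmod_n]),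
      ZMod.card, ← pow_mul, ← pow_mul, mul_comm t k]
  have h2 := sum_eq_add_sum_range hg (fun x : ZMod p => (1 + x) ^ (p / 2) * x ^ t)
  simp only [h1]
  simp only [zero_pow ht.ne', mul_zero, zero_add] at h2
  rw [← h2]
  simp only [add_comm (1 : ZMod p), add_pow, one_pow, mul_one, Finset.sum_mul]
  rw [Finset.sum_comm]
  refine Finset.sum_eq_zero fun i hi => ?_
  have h3 : ∀ x : ZMod p, x ^ i * ((p / 2).choose i : ZMod p) * x ^ t =
      ((p / 2).choose i : ZMod p) * x ^ (i + t) := fun x => by ring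
  simp only [h3]
  rw [← Finset.mul_sum, FiniteField.sum_pow_lt_card_sub_one, mul_zero]
  rw [Finset.mem_range] at hi
  rw [ZMod.card]; omega

end Generator

/-! ### Reduction of `Y p` to a circulant. -/

section Determinant

variable {p : ℕ} [Fact p.Prime] {g : (ZMod p)ˣ}

theorem generator_pow_six_mul_val (g : (ZMod p)ˣ) {n : ℕ} [NeZero n] (hn : p - 1 = 6 * n) (k : ℕ) :
    (g : ZMod p) ^ (6 * (k : ZMod n).val) = (g : ZMod p) ^ (6 * k) := by
  rw [ZMod.val_natCast]
  conv_rhs => rw [← Nat.mod_add_div k n, mul_add, pow_add, ← mul_assoc, ← hn,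
    pow_mul _ (p - 1), generator_pow_card_sub_one, one_pow, mul_one]

theorem sum_zmod_val_eq_sum_range {M : Type*} [AddCommMonoid M] (n : ℕ) [NeZero n] (F : ℕ → M) :
    ∑ k : ZMod n, F k.val = ∑ k ∈ Finset.range n, F k := by
  refine Finset.sum_nbij' (fun r => r.val) (fun r => (r : ZMod n)) ?_ ?_ ?_ ?_ ?_
  · intro a _; simpa using ZMod.val_lt a
  · simp
  · simp
  · intro a ha; exact ZMod.val_natCast_of_lt (by simpa using ha)
  · simp

open Classical in
/-- The sixth-power residues are the powers of the sixth power of a generator. -/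
theorem exists_equiv_sixthPowerResidue (hg : orderOf g = p - 1) {n : ℕ} [NeZero n]
    (hn : p - 1 = 6 * n) :
    ∃ e : ZMod n ≃ Fin (sixthPowerResidues p).card,
      ∀ k, ((sixthPowerResidue p (e k) : ℕ) : ZMod p) = (g : ZMod p) ^ (6 * k.val) := by
  have hmem : ∀ k : ZMod n, ((g : ZMod p) ^ (6 * k.val)).val ∈ sixthPowerResidues p := by
    intro k
    rw [sixthPowerResidues, Finset.mem_filter, Finset.mem_Ioo]
    refine ⟨⟨?_, ZMod.val_lt _⟩, ((g : ZMod p) ^ k.val).val, ?_⟩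
    · rw [Nat.pos_iff_ne_zero, Ne, ZMod.val_eq_zero]
      exact pow_ne_zero _ g.ne_zero
    · rw [← ZMod.intCast_eq_intCast_iff]
      push_cast
      rw [ZMod.natCast_zmod_val, ZMod.natCast_zmod_val]
      ring
  let e₀ : ZMod n → sixthPowerResidues p := fun k => ⟨_, hmem k⟩
  have hbij : Function.Bijective e₀ := by
    constructor
    · intro a b hab
      have h1 := ZMod.val_injective p (Subtype.ext_iff.mp hab)
      have ha := ZMod.val_lt a
      have hb := ZMod.val_lt b
      have h2 := generator_pow_injOn hg (by simp only [Set.mem_Iio]; omega)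
        (by simp only [Set.mem_Iio]; omega) h1
      exact ZMod.val_injective n (by omega)
    · rintro ⟨c, hc⟩
      have hc' := hc
      rw [sixthPowerResidues, Finset.mem_filter, Finset.mem_Ioo] at hc'
      obtain ⟨⟨hc0, hcp⟩, x, hx⟩ := hc'
      rw [← ZMod.intCast_eq_intCast_iff] at hx
      push_cast at hx
      have hx0 : (x : ZMod p) ≠ 0 := by
        intro h
        rw [h, zero_pow (by norm_num), eq_comm, ZMod.natCast_eq_zero_iff] at hx
        have := Nat.le_of_dvd hc0 hx
        omega
      have hgen : Units.mk0 (x : ZMod p) hx0 ∈ Subgroup.zpowers g := by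
        have : Subgroup.zpowers g = ⊤ := by
          apply Subgroup.eq_top_of_card_eq
          rw [Nat.card_zpowers, hg, Nat.card_eq_fintype_card, ZMod.card_units]
        rw [this]; trivial
      rw [← mem_powers_iff_mem_zpowers] at hgen
      obtain ⟨k, hk⟩ := hgen
      have hk' : (g : ZMod p) ^ k = x := by
        have := congrArg (Units.val) hk
        simpa using this
      refine ⟨(k : ZMod n), Subtype.ext ?_⟩
      change ((g : ZMod p) ^ (6 * (k : ZMod n).val)).val = c
      rw [generator_pow_six_mul_val g hn, mul_comm, pow_mul, hk', hx, ZMod.val_natCast_of_lt hcp]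
  refine ⟨(Equiv.ofBijective e₀ hbij).trans
    ((sixthPowerResidues p).orderIsoOfFin rfl).symm.toEquiv, fun k => ?_⟩
  have : sixthPowerResidue p (((Equiv.ofBijective e₀ hbij).trans
    ((sixthPowerResidues p).orderIsoOfFin rfl).symm.toEquiv) k) = (e₀ k : ℕ) := by
    rw [sixthPowerResidue, ← Finset.coe_orderIsoOfFin_apply]
    simp
  rw [this]
  exact ZMod.natCast_zmod_val _

theorem exists_Y_eq (hp : p ≠ 2) (hg : orderOf g = p - 1) {n : ℕ} (hn0 : n ≠ 0)
    (hn : p - 1 = 6 * n) :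
    ∃ z : ℤ, Y p = (∑ k ∈ Finset.range n, shiftedChar g (6 * k)) *
      (if Even n then ∑ k ∈ Finset.range n, shiftedChar g (6 * k) * (-1) ^ k else 1) * z ^ 2 := by
  have : NeZero n := ⟨hn0⟩
  obtain ⟨e, he⟩ := exists_equiv_sixthPowerResidue hg hn
  let f : ZMod n → ℤ := fun k => shiftedChar g (6 * k.val)
  have hf : ∀ k, f (-k) = f k := by
    intro k
    have hk := ZMod.val_lt k
    simp only [f]
    rw [ZMod.neg_val]
    split_ifs with h
    · simp [h]
    · rw [show 6 * (n - k.val) = p - 1 - 6 * k.val by omega,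
        shiftedChar_card_sub_one_sub hp hg (by omega), pow_mul]
      norm_num
  have hY : Y p = (Matrix.of fun i j => f (i - j)).det := by
    rw [Y, ← Matrix.det_submatrix_equiv_self e]
    congr 1
    ext i j
    simp only [Matrix.submatrix_apply, Matrix.of_apply, legendreSym, f, shiftedChar]
    push_cast
    rw [he, he]
    have h1 : (g : ZMod p) ^ (6 * (i - j).val) * (g : ZMod p) ^ (6 * j.val) =
        (g : ZMod p) ^ (6 * i.val) := by
      rw [← pow_add, ← mul_add, ← generator_pow_six_mul_val g hn]
      push_cast
      rw [ZMod.natCast_zmod_val, ZMod.natCast_zmod_val, sub_add_cancel]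
    rw [← h1, ← add_one_mul, map_mul, quadraticChar_generator_pow hp hg (6 * j.val), pow_mul]
    norm_num [add_comm]
  obtain ⟨z, hz⟩ := Matrix.exists_det_circulant_even n f hf
  refine ⟨z, ?_⟩
  rw [hY, hz, sum_zmod_val_eq_sum_range n (fun k => shiftedChar g (6 * k)),
    sum_zmod_val_eq_sum_range n (fun k => shiftedChar g (6 * k) * (-1) ^ k)]

end Determinant

/-! ### Sums by residue class, and uniqueness of p = x² + Dy². -/

theorem Finset.sum_range_mul_eq {M : Type*} [AddCommMonoid M] (d m : ℕ) (F : ℕ → M) :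
    ∑ k ∈ Finset.range (d * m), F k =
      ∑ j ∈ Finset.range d, ∑ i ∈ Finset.range m, F (d * i + j) := by
  induction m with
  | zero => simp
  | succ m ih =>
    rw [Nat.mul_succ, Finset.sum_range_add, ih, ← Finset.sum_add_distrib]
    exact Finset.sum_congr rfl fun j _ => (Finset.sum_range_succ _ _).symm

theorem sum_range_mul_pow_eq {R : Type*} [CommRing R] (d m : ℕ) (F : ℕ → ℤ) {ζ : R}
    (hζ : ζ ^ d = 1) :
    ∑ k ∈ Finset.range (d * m), (F k : R) * ζ ^ k =
      ∑ j ∈ Finset.range d, ((∑ i ∈ Finset.range m, F (d * i + j) : ℤ) : R) * ζ ^ j := by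
  rw [Finset.sum_range_mul_eq]
  refine Finset.sum_congr rfl fun j _ => ?_
  rw [Int.cast_sum, Finset.sum_mul]
  refine Finset.sum_congr rfl fun i _ => ?_
  rw [pow_add, pow_mul, hζ, one_pow, one_mul]

theorem Finset.even_sum_sub_card {ι : Type*} (s : Finset ι) (F : ι → ℤ) (h : ∀ i ∈ s, Odd (F i)) :
    Even (∑ i ∈ s, F i - s.card) := by
  have : ∑ i ∈ s, F i - s.card = ∑ i ∈ s, (F i - 1) := by simp
  rw [this]
  exact Finset.even_sum _ fun i hi => (h i hi).sub_odd odd_one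

/-- `p` divides xb - ay or xb + ay. In the composition identity p² = (xa + Dyb)² + D(xb - ay)², a
nonzero multiple of `p` as second entry would give Dp² ≤ p², impossible for D > 1. For D = 1 the two
squares could be swapped. -/
theorem sq_eq_of_prime_eq_sq_add_mul_sq {p : ℕ} (hp : p.Prime) {D x y a b : ℤ} (hD : 1 < D)
    (h1 : (p : ℤ) = x ^ 2 + D * y ^ 2) (h2 : (p : ℤ) = a ^ 2 + D * b ^ 2) : x ^ 2 = a ^ 2 := by
  have hp0 : (0 : ℤ) < p := by exact_mod_cast hp.pos
  have key : ∀ a : ℤ, (p : ℤ) = a ^ 2 + D * b ^ 2 → (p : ℤ) ∣ x * b - a * y → x ^ 2 = a ^ 2 := by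
    rintro a h2 ⟨t, ht⟩
    have h3 : (p : ℤ) ^ 2 = (x * a + D * y * b) ^ 2 + D * (p * t) ^ 2 := by
      rw [← ht]
      calc (p : ℤ) ^ 2 = p * p := by ring
        _ = (x ^ 2 + D * y ^ 2) * (a ^ 2 + D * b ^ 2) := by rw [← h1, ← h2]
        _ = _ := by ring
    have ht0 : t = 0 := by
      by_contra h
      have h4 : 1 ≤ t ^ 2 := by
        have := sq_pos_of_ne_zero h
        omega
      have h5 : (p : ℤ) ^ 2 * (D * t ^ 2) ≤ p ^ 2 * 1 := by
        nlinarith [sq_nonneg (x * a + D * y * b)]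
      have h6 := le_of_mul_le_mul_left h5 (by positivity)
      nlinarith
    rw [ht0, mul_zero] at ht
    have h7 : x ^ 2 * b ^ 2 = a ^ 2 * y ^ 2 := by linear_combination (x * b + a * y) * ht
    have h8 : (p : ℤ) * (b ^ 2 - y ^ 2) = 0 := by
      linear_combination b ^ 2 * h1 - y ^ 2 * h2 + h7
    have h9 : b ^ 2 = y ^ 2 := by
      rcases mul_eq_zero.mp h8 with h | h <;> linarith
    linear_combination h2 - h1 + D * h9
  have hdvd : (p : ℤ) ∣ (x * b - a * y) * (x * b - (-a) * y) :=
    ⟨b ^ 2 - y ^ 2, by linear_combination -b ^ 2 * h1 + y ^ 2 * h2⟩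
  rcases (Nat.prime_iff_prime_int.mp hp).dvd_or_dvd hdvd with h | h
  · exact key a h2 h
  · rw [key (-a) (by rw [neg_sq]; exact h2) h, neg_sq]

/-! ### The eigenvalue at 0, by cubic characters. -/

section Cubic

variable {p : ℕ} [Fact p.Prime] {g : (ZMod p)ˣ}

/-- Inverting g^(6i+3) permutes the terms and, the exponent being odd, changes their signs. -/
theorem sum_shiftedChar_six_mul_add_three (hp : p ≠ 2) (hg : orderOf g = p - 1) {n : ℕ}
    (hn : p - 1 = 6 * n) : ∑ i ∈ Finset.range n, shiftedChar g (6 * i + 3) = 0 := by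
  have h : ∑ i ∈ Finset.range n, shiftedChar g (6 * i + 3) =
      ∑ i ∈ Finset.range n, -shiftedChar g (6 * i + 3) := by
    rw [← Finset.sum_range_reflect]
    refine Finset.sum_congr rfl fun i hi => ?_
    rw [Finset.mem_range] at hi
    rw [show 6 * (n - 1 - i) + 3 = p - 1 - (6 * i + 3) by omega,
      shiftedChar_card_sub_one_sub hp hg (by omega), pow_add, pow_mul]
    norm_num
  rw [Finset.sum_neg_distrib] at h
  linarith

/-- The sum of the quadratic character over one plus the sixth powers, in terms of the
representation of `p` by `x ^ 2 + 3 * y ^ 2`. -/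
theorem three_mul_sum_shiftedChar_six_mul (hp : p ≠ 2) (hg : orderOf g = p - 1) {n : ℕ}
    (hn0 : n ≠ 0) (hn : p - 1 = 6 * n) {x y : ℤ} (hx : x ≡ 1 [ZMOD 3])
    (hxy : (p : ℤ) = x ^ 2 + 3 * y ^ 2) :
    3 * ∑ k ∈ Finset.range n, shiftedChar g (6 * k) = -(1 + 2 * x) := by
  set M : ℕ → ℤ := fun j => ∑ i ∈ Finset.range (2 * n), shiftedChar g (3 * i + j) with hM
  have hn3 : p - 1 = 3 * (2 * n) := by omega
  have hM0 : M 0 = ∑ k ∈ Finset.range n, shiftedChar g (6 * k) := by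
    have h := sum_shiftedChar_six_mul_add_three hp hg hn
    simp only [hM, add_zero]
    rw [Finset.sum_range_mul_eq, Finset.sum_range_succ, Finset.sum_range_one]
    simp only [mul_add, ← mul_assoc, Nat.reduceMul, add_zero, mul_one, h]
  rw [← hM0]
  have hsum : M 0 + M 1 + M 2 = -1 := by
    have h := sum_shiftedChar hp hg
    rw [hn3, Finset.sum_range_mul_eq] at h
    simpa [Finset.sum_range_succ, hM] using h
  -- The norm of M₀ + M₁w + M₂w² for a primitive cube root of unity w, combined with M₀ + M₁ + M₂ =
  -- -1.
  have hnorm : 4 * (p : ℤ) = (3 * M 0 + 1) ^ 2 + 3 * (M 1 - M 2) ^ 2 := by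
    obtain ⟨w, hw⟩ : ∃ w : ℂ, IsPrimitiveRoot w 3 := ⟨_, Complex.isPrimitiveRoot_exp 3 (by norm_num)⟩
    have hw3 := hw.pow_eq_one
    have hw1 : w ≠ 1 := hw.ne_one (by norm_num)
    have hw2 : w ^ 2 + w + 1 = 0 := by
      have : (w - 1) * (w ^ 2 + w + 1) = 0 := by linear_combination hw3
      exact (mul_eq_zero.mp this).resolve_left (sub_ne_zero.mpr hw1)
    have hinv : w⁻¹ = w ^ 2 := inv_eq_of_mul_eq_one_right (by linear_combination hw3)
    have h := sum_shiftedChar_mul_pow_mul hp hg w (by rw [hn3, pow_mul, hw3, one_pow])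
      (by intro h; apply hw1; linear_combination hw3 - w * h)
    rw [hinv, hn3, sum_range_mul_pow_eq 3 _ _ hw3,
      sum_range_mul_pow_eq 3 _ _ (by linear_combination (w ^ 3 + 1) * hw3)] at h
    have h' : ((M 0 : ℂ) + M 1 * w + M 2 * w ^ 2) * (M 0 + M 1 * w ^ 2 + M 2 * w ^ 4) = p := by
      rw [← h]
      simp only [Finset.sum_range_succ, Finset.sum_range_zero, hM]
      ring
    have h3 : (p : ℤ) = M 0 ^ 2 + M 1 ^ 2 + M 2 ^ 2 - M 0 * M 1 - M 1 * M 2 - M 0 * M 2 := by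
      have : ((p : ℤ) : ℂ) = ((M 0 ^ 2 + M 1 ^ 2 + M 2 ^ 2 - M 0 * M 1 - M 1 * M 2 - M 0 * M 2 : ℤ) : ℂ) := by
        push_cast
        rw [← h']
        have h4 : w ^ 2 = -w - 1 := by linear_combination hw2
        have h5 : w ^ 4 = w := by linear_combination w * hw3
        rw [h5, h4]
        ring_nf
        rw [h4]
        ring
      exact_mod_cast this
    have h6 : M 2 = -1 - M 0 - M 1 := by linarith
    rw [h3, h6]; ring
  -- The term at i = n vanishes since g^(3n) = -1; the other 2n - 1 terms are ±1.
  have hodd : Odd (M 0) := by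
    have hmem : n ∈ Finset.range (2 * n) := by rw [Finset.mem_range]; omega
    have hzero : shiftedChar g (3 * n + 0) = 0 := by
      rw [show 3 * n + 0 = p / 2 by omega, shiftedChar_half hp hg]
    simp only [hM]
    rw [← Finset.add_sum_erase _ _ hmem, hzero, zero_add]
    have h := Finset.even_sum_sub_card ((Finset.range (2 * n)).erase n)
      (fun i => shiftedChar g (3 * i + 0)) (by
        intro i hi
        rw [Finset.mem_erase, Finset.mem_range] at hi
        exact odd_shiftedChar hp hg (by omega) (by omega))
    rw [Finset.card_erase_of_mem hmem, Finset.card_range] at h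
    obtain ⟨t, ht⟩ := h
    refine ⟨t + n - 1, ?_⟩
    push_cast [Nat.cast_sub (show 1 ≤ 2 * n by omega)] at ht
    linarith
  obtain ⟨m, hm⟩ := hodd
  obtain ⟨s, hs⟩ : ∃ s, M 1 - M 2 = 2 * s := by
    rcases Int.even_or_odd' (M 1 - M 2) with ⟨s, hs | hs⟩
    · exact ⟨s, hs⟩
    · exfalso
      rw [hm, hs] at hnorm
      ring_nf at hnorm
      omega
  have hrep : (p : ℤ) = (3 * m + 2) ^ 2 + 3 * s ^ 2 := by
    rw [hm, hs] at hnorm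
    linarith
  have hsq := sq_eq_of_prime_eq_sq_add_mul_sq (Fact.out : p.Prime) (by norm_num) hxy hrep
  -- x ≡ 1 mod 3 excludes x = 3m + 2, leaving x = -(3m + 2).
  rcases sq_eq_sq_iff_eq_or_eq_neg.mp hsq with h | h
  · exfalso
    rw [Int.ModEq] at hx
    omega
  · rw [hm, h]; ring

end Cubic

/-! ### The eigenvalue at n/2, by characters of order 4 and 12. -/

/-- The ring is arbitrary so that the same formula serves in ℂ and in `ZMod p`. The relations on `W`
are those of `classSum_reflect`. -/
theorem sum_range_twelve_mul_pow_quartic {R : Type*} [CommRing R] (W : ℕ → ℤ) {i : R}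
    (hi : i ^ 2 = -1) (h7 : W 7 = -W 5) (h8 : W 8 = W 4) (h9 : W 9 = -W 3) (h10 : W 10 = W 2)
    (h11 : W 11 = -W 1) :
    ∑ j ∈ Finset.range 12, (W j : R) * i ^ j =
      ((W 0 - W 6 + 2 * W 4 - 2 * W 2 : ℤ) : R) + ((2 * (W 1 - W 3 + W 5) : ℤ) : R) * i := by
  have h3 : i ^ 3 = -i := by linear_combination i * hi
  have h4 : i ^ 4 = 1 := by linear_combination (i ^ 2 - 1) * hi
  simp only [Finset.sum_range_succ, Finset.sum_range_zero, h7, h8, h9, h10, h11,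
    show i ^ 5 = i ^ 4 * i by ring, show i ^ 6 = i ^ 4 * i ^ 2 by ring,
    show i ^ 7 = i ^ 4 * i ^ 3 by ring, show i ^ 8 = i ^ 4 * i ^ 4 by ring,
    show i ^ 9 = i ^ 4 * i ^ 4 * i by ring, show i ^ 10 = i ^ 4 * i ^ 4 * i ^ 2 by ring,
    show i ^ 11 = i ^ 4 * i ^ 4 * i ^ 3 by ring, h3, h4, hi]
  push_cast
  ring

theorem sum_range_twelve_mul_pow_twelfth {R : Type*} [CommRing R] (W : ℕ → ℤ) {i w : R}
    (hi : i ^ 2 = -1) (hw : w ^ 2 + w + 1 = 0) (h7 : W 7 = -W 5) (h8 : W 8 = W 4)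
    (h9 : W 9 = -W 3) (h10 : W 10 = W 2) (h11 : W 11 = -W 1) :
    ∑ j ∈ Finset.range 12, (W j : R) * (i * w) ^ j =
      ((W 0 - W 6 - W 4 + W 2 : ℤ) : R) + ((-(W 1 + 2 * W 3 + W 5) : ℤ) : R) * i := by
  have h3 : i ^ 3 = -i := by linear_combination i * hi
  have h4 : i ^ 4 = 1 := by linear_combination (i ^ 2 - 1) * hi
  have hw2 : w ^ 2 = -w - 1 := by linear_combination hw
  have hw3 : w ^ 3 = 1 := by linear_combination (w - 1) * hw
  simp only [Finset.sum_range_succ, Finset.sum_range_zero, h7, h8, h9, h10, h11, mul_pow,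
    show i ^ 5 = i ^ 4 * i by ring, show i ^ 6 = i ^ 4 * i ^ 2 by ring,
    show i ^ 7 = i ^ 4 * i ^ 3 by ring, show i ^ 8 = i ^ 4 * i ^ 4 by ring,
    show i ^ 9 = i ^ 4 * i ^ 4 * i by ring, show i ^ 10 = i ^ 4 * i ^ 4 * i ^ 2 by ring,
    show i ^ 11 = i ^ 4 * i ^ 4 * i ^ 3 by ring, h3, h4, hi,
    show w ^ 4 = w ^ 3 * w by ring, show w ^ 5 = w ^ 3 * w ^ 2 by ring,
    show w ^ 6 = w ^ 3 * w ^ 3 by ring, show w ^ 7 = w ^ 3 * w ^ 3 * w by ring,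
    show w ^ 8 = w ^ 3 * w ^ 3 * w ^ 2 by ring, show w ^ 9 = w ^ 3 * w ^ 3 * w ^ 3 by ring,
    show w ^ 10 = w ^ 3 * w ^ 3 * w ^ 3 * w by ring,
    show w ^ 11 = w ^ 3 * w ^ 3 * w ^ 3 * w ^ 2 by ring, hw3, hw2]
  push_cast
  ring

section Quartic

variable {p : ℕ} [Fact p.Prime] {g : (ZMod p)ˣ}

/-- The sum of the shifted quadratic character over the exponents congruent to `j` mod `12`. -/
def classSum (g : (ZMod p)ˣ) (k j : ℕ) : ℤ := ∑ i ∈ Finset.range k, shiftedChar g (12 * i + j)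

theorem classSum_reflect (hp : p ≠ 2) (hg : orderOf g = p - 1) {k : ℕ} (hk : p - 1 = 12 * k)
    {j : ℕ} (hj : j ≤ 12) : classSum g k (12 - j) = (-1) ^ j * classSum g k j := by
  rw [classSum, ← Finset.sum_range_reflect, classSum, Finset.mul_sum]
  refine Finset.sum_congr rfl fun i hi => ?_
  rw [Finset.mem_range] at hi
  rw [show 12 * (k - 1 - i) + (12 - j) = p - 1 - (12 * i + j) by omega,
    shiftedChar_card_sub_one_sub hp hg (by omega), pow_add, pow_mul]
  norm_num

theorem even_classSum_sub (hp : p ≠ 2) (hg : orderOf g = p - 1) {k : ℕ} (hk : p - 1 = 12 * k)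
    {j : ℕ} (hj : j < 12) (hj6 : ¬ 6 ∣ j) : Even (classSum g k j - k) := by
  have h := Finset.even_sum_sub_card (Finset.range k) (fun i => shiftedChar g (12 * i + j)) (by
    intro i hi
    rw [Finset.mem_range] at hi
    exact odd_shiftedChar hp hg (by omega) (by omega))
  rwa [Finset.card_range] at h

theorem sum_shiftedChar_six_mul_neg_one_pow (g : (ZMod p)ˣ) (k : ℕ) :
    ∑ i ∈ Finset.range (2 * k), shiftedChar g (6 * i) * (-1) ^ i =
      classSum g k 0 - classSum g k 6 := by
  rw [Finset.sum_range_mul_eq, Finset.sum_range_succ, Finset.sum_range_one, classSum, classSum,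
    sub_eq_add_neg, ← Finset.sum_neg_distrib]
  congr 1 <;> refine Finset.sum_congr rfl fun i _ => ?_
  · rw [show 6 * (2 * i + 0) = 12 * i + 0 by ring, add_zero, add_zero, pow_mul]; norm_num
  · rw [show 6 * (2 * i + 1) = 12 * i + 6 by ring, pow_succ, pow_mul]; norm_num

theorem sum_range_two_mul_of_symm {G : ℕ → ℤ} {k : ℕ} (hk : k ≠ 0)
    (hG : ∀ i ≤ 2 * k, G (2 * k - i) = G i) :
    ∑ i ∈ Finset.range (2 * k), G i = G 0 + G k + 2 * ∑ i ∈ Finset.range (k - 1), G (i + 1) := by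
  have h1 : ∑ i ∈ Finset.range (k - 1), G (k + 1 + i) = ∑ i ∈ Finset.range (k - 1), G (i + 1) := by
    rw [← Finset.sum_range_reflect]
    refine Finset.sum_congr rfl fun i hi => ?_
    rw [Finset.mem_range] at hi
    rw [← hG (i + 1) (by omega)]
    congr 1; omega
  rw [show 2 * k = k + 1 + (k - 1) by omega, Finset.sum_range_add, h1,
    Finset.sum_range_succ, show Finset.range k = Finset.range (k - 1 + 1) by congr 1; omega,
    Finset.sum_range_succ']
  ring

theorem legendreSym_two_eq_neg_one_pow {k : ℕ} (hk0 : k ≠ 0) (hk : p - 1 = 12 * k) :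
    legendreSym p 2 = (-1) ^ k := by
  have hp : p ≠ 2 := by omega
  have h0 : ((2 : ℤ) : ZMod p) ≠ 0 := by
    have : ((2 : ℕ) : ZMod p) ≠ 0 := by
      rw [Ne, ZMod.natCast_eq_zero_iff]
      intro h
      have := Nat.le_of_dvd (by norm_num) h
      omega
    exact_mod_cast this
  rcases Nat.even_or_odd k with he | ho
  · rw [he.neg_one_pow, legendreSym.eq_one_iff p h0]
    push_cast
    rw [ZMod.exists_sq_eq_two_iff hp]
    obtain ⟨m, rfl⟩ := he
    omega
  · rw [ho.neg_one_pow, legendreSym.eq_neg_one_iff]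
    push_cast
    rw [ZMod.exists_sq_eq_two_iff hp]
    obtain ⟨m, rfl⟩ := ho
    omega

/-- In the alternating sum over i < 2k, the term i = 0 is (2/p) = (-1)^k, the term i = k is 0, and
the rest pair off into twice a sum of k - 1 odd numbers. So the value is (-1)^k + 2(k - 1) modulo 4.
-/
theorem classSum_zero_sub_six_modEq (hp : p ≠ 2) (hg : orderOf g = p - 1) {k : ℕ} (hk0 : k ≠ 0)
    (hk : p - 1 = 12 * k) : classSum g k 0 - classSum g k 6 ≡ -1 [ZMOD 4] := by
  have hodd : ∀ i ∈ Finset.range (k - 1), Odd (shiftedChar g (6 * (i + 1)) * (-1) ^ (i + 1)) := by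
    intro i hi
    rw [Finset.mem_range] at hi
    exact (odd_shiftedChar hp hg (by omega) (by omega)).mul (Odd.pow (by decide))
  obtain ⟨t, ht⟩ := Finset.even_sum_sub_card _ _ hodd
  rw [Finset.card_range] at ht
  rw [← sum_shiftedChar_six_mul_neg_one_pow, sum_range_two_mul_of_symm hk0]
  · have h6 : shiftedChar g (6 * k) = 0 := by
      rw [show 6 * k = p / 2 by omega, shiftedChar_half hp hg]
    have h0 : shiftedChar g (6 * 0) = (-1) ^ k := by
      rw [← legendreSym_two_eq_neg_one_pow hk0 hk, shiftedChar, legendreSym]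
      norm_num
    rw [h6, h0, Int.modEq_iff_dvd]
    push_cast [Nat.cast_sub (show 1 ≤ k by omega)] at ht
    rcases Nat.even_or_odd' k with ⟨m, hm | hm⟩
    · rw [(show Even k from ⟨m, by omega⟩).neg_one_pow, pow_zero]
      refine ⟨-m - t, ?_⟩
      rw [hm] at ht ⊢
      push_cast at ht
      linarith
    · rw [(show Odd k from ⟨m, hm⟩).neg_one_pow, pow_zero]
      refine ⟨-m - t, ?_⟩
      rw [hm] at ht ⊢
      push_cast at ht
      rw [Nat.add_sub_cancel]
      linarith
  · intro i hi
    rw [show 6 * (2 * k - i) = p - 1 - 6 * i by omega,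
      shiftedChar_card_sub_one_sub hp hg (by omega), pow_mul]
    have h1 : (-1 : ℤ) ^ (2 * k - i) = (-1) ^ i := by
      rw [neg_one_pow_eq_pow_mod_two, neg_one_pow_eq_pow_mod_two (n := i)]
      congr 1; omega
    rw [h1]; norm_num

/-- The duodecimal character sum in terms of the representation of `p` by `x ^ 2 + 4 * y ^ 2`. -/
theorem classSum_zero_sub_six_eq (hg : orderOf g = p - 1) {k : ℕ} (hk0 : k ≠ 0)
    (hk : p - 1 = 12 * k) {x y : ℤ} (hx : x ≡ legendreSym p 2 [ZMOD 4])
    (hxy : (p : ℤ) = x ^ 2 + 4 * y ^ 2) :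
    (3 ∣ x → 3 * (classSum g k 0 - classSum g k 6) = (-1) ^ k * x) ∧
      (¬ 3 ∣ x → classSum g k 0 - classSum g k 6 = -((-1) ^ k * x)) := by
  have hp : p ≠ 2 := by omega
  have hprime := (Fact.out : p.Prime)
  have hp1 : (p : ℤ) = 12 * k + 1 := by omega
  set W := classSum g k with hW
  have h7 : W 7 = -W 5 := by simpa using classSum_reflect hp hg hk (j := 5) (by norm_num)
  have h8 : W 8 = W 4 := by simpa using classSum_reflect hp hg hk (j := 4) (by norm_num)
  have h9 : W 9 = -W 3 := by simpa using classSum_reflect hp hg hk (j := 3) (by norm_num)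
  have h10 : W 10 = W 2 := by simpa using classSum_reflect hp hg hk (j := 2) (by norm_num)
  have h11 : W 11 = -W 1 := by simpa using classSum_reflect hp hg hk (j := 1) (by norm_num)
  set a := W 0 - W 6 + 2 * W 4 - 2 * W 2 with ha
  set b := 2 * (W 1 - W 3 + W 5) with hb
  set c := W 0 - W 6 - W 4 + W 2 with hc
  set d := -(W 1 + 2 * W 3 + W 5) with hd
  have hS : ∀ {R : Type} [CommRing R] {ζ : R}, ζ ^ 12 = 1 →
      ∑ i ∈ Finset.range (p - 1), (shiftedChar g i : R) * ζ ^ i =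
        ∑ j ∈ Finset.range 12, (W j : R) * ζ ^ j := by
    intro R _ ζ hζ
    rw [hk, sum_range_mul_pow_eq 12 k _ hζ]
    rfl
  -- the Jacobi sums `a + b i` and `c + d i` have absolute value `√p`
  have hab : (p : ℤ) = a ^ 2 + b ^ 2 := by
    have hI : Complex.I ^ 12 = 1 := by
      rw [show 12 = 4 * 3 by norm_num, pow_mul, Complex.I_pow_four, one_pow]
    have h := sum_shiftedChar_mul_pow_mul hp hg Complex.I (by rw [hk, pow_mul, hI, one_pow])
      (by rw [Complex.I_sq]; norm_num)
    rw [Complex.inv_I, hS hI, hS (by rw [Even.neg_pow (by decide), hI]),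
      sum_range_twelve_mul_pow_quartic W Complex.I_sq h7 h8 h9 h10 h11,
      sum_range_twelve_mul_pow_quartic W (by rw [neg_sq, Complex.I_sq]) h7 h8 h9 h10 h11,
      ← ha, ← hb] at h
    have : ((p : ℤ) : ℂ) = ((a ^ 2 + b ^ 2 : ℤ) : ℂ) := by
      push_cast
      rw [← h]
      linear_combination -(b : ℂ) ^ 2 * Complex.I_sq
    exact_mod_cast this
  have hcd : (p : ℤ) = c ^ 2 + d ^ 2 := by
    obtain ⟨w, hw⟩ : ∃ w : ℂ, IsPrimitiveRoot w 3 := ⟨_, Complex.isPrimitiveRoot_exp 3 (by norm_num)⟩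
    have hw3 := hw.pow_eq_one
    have hw1 : w ≠ 1 := hw.ne_one (by norm_num)
    have hw2 : w ^ 2 + w + 1 = 0 := by
      have : (w - 1) * (w ^ 2 + w + 1) = 0 := by linear_combination hw3
      exact (mul_eq_zero.mp this).resolve_left (sub_ne_zero.mpr hw1)
    have hI : Complex.I ^ 12 = 1 := by
      rw [show 12 = 4 * 3 by norm_num, pow_mul, Complex.I_pow_four, one_pow]
    have hζ : (Complex.I * w) ^ 12 = 1 := by
      rw [mul_pow, hI, show w ^ 12 = (w ^ 3) ^ 4 by ring, hw3]; norm_num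
    have hinv : (Complex.I * w)⁻¹ = -Complex.I * w ^ 2 := by
      apply inv_eq_of_mul_eq_one_right
      linear_combination -w ^ 3 * Complex.I_sq + hw3
    have hζ' : (-Complex.I * w ^ 2) ^ 12 = 1 := by rw [← hinv, inv_pow, hζ, inv_one]
    have h := sum_shiftedChar_mul_pow_mul hp hg (Complex.I * w) (by rw [hk, pow_mul, hζ, one_pow])
      (by
        intro h
        have h1 : w ^ 2 = -1 := by linear_combination -h + w ^ 2 * Complex.I_sq
        have h2 : w = 0 := by linear_combination hw2 - h1
        rw [h2] at h1; norm_num at h1)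
    rw [hinv, hS hζ, hS hζ',
      sum_range_twelve_mul_pow_twelfth W Complex.I_sq hw2 h7 h8 h9 h10 h11,
      sum_range_twelve_mul_pow_twelfth W (by rw [neg_sq, Complex.I_sq])
        (by linear_combination w * hw3 + hw2) h7 h8 h9 h10 h11,
      ← hc, ← hd] at h
    have : ((p : ℤ) : ℂ) = ((c ^ 2 + d ^ 2 : ℤ) : ℂ) := by
      push_cast
      rw [← h]
      linear_combination -(d : ℂ) ^ 2 * Complex.I_sq
    exact_mod_cast this
  -- modulo a prime above `p`, the first sum and the conjugate of the second vanish
  obtain ⟨i, hi, hia, hic⟩ : ∃ i : ZMod p, i ^ 2 = -1 ∧ (a : ZMod p) + b * i = 0 ∧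
      (c : ZMod p) - d * i = 0 := by
    have hg12 : (g : ZMod p) ^ (12 * k) = 1 := by rw [← hk, generator_pow_card_sub_one]
    have hg6 : (g : ZMod p) ^ (6 * k) = -1 := by
      rw [show 6 * k = p / 2 by omega, generator_pow_half hp hg]
    have hi : ((g : ZMod p) ^ (3 * k)) ^ 2 = -1 := by rw [← hg6]; ring
    have hu3 : ((g : ZMod p) ^ (4 * k)) ^ 3 = 1 := by rw [← hg12]; ring
    have hu1 : (g : ZMod p) ^ (4 * k) ≠ 1 := by
      intro h
      have := generator_pow_injOn hg (show 4 * k ∈ Set.Iio (p - 1) by simp only [Set.mem_Iio]; omega)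
        (show 0 ∈ Set.Iio (p - 1) by simp only [Set.mem_Iio]; omega) (by simpa using h)
      omega
    have hu : ((g : ZMod p) ^ (4 * k)) ^ 2 + (g : ZMod p) ^ (4 * k) + 1 = 0 := by
      have : ((g : ZMod p) ^ (4 * k) - 1) *
          (((g : ZMod p) ^ (4 * k)) ^ 2 + (g : ZMod p) ^ (4 * k) + 1) = 0 := by
        linear_combination hu3
      exact (mul_eq_zero.mp this).resolve_left (sub_ne_zero.mpr hu1)
    refine ⟨(g : ZMod p) ^ (3 * k), hi, ?_, ?_⟩
    · have h := sum_shiftedChar_mul_pow_eq_zero hp hg (t := 3 * k) (by omega) (by omega)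
      rwa [hS (by rw [← pow_mul, show 3 * k * 12 = 12 * k * 3 by ring, pow_mul, hg12, one_pow]),
        sum_range_twelve_mul_pow_quartic W hi h7 h8 h9 h10 h11] at h
    -- The vanishing needs t < 6k. The image of iw is g^(7k), out of range; its inverse g^(5k) is in
    -- range, which is why the conjugate c - di appears.
    · have h := sum_shiftedChar_mul_pow_eq_zero hp hg (t := 5 * k) (by omega) (by omega)
      have h5 : (g : ZMod p) ^ (5 * k) =
          -(g : ZMod p) ^ (3 * k) * ((g : ZMod p) ^ (4 * k)) ^ 2 := by
        calc (g : ZMod p) ^ (5 * k) = (g : ZMod p) ^ (5 * k) * 1 := by rw [mul_one]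
          _ = (g : ZMod p) ^ (5 * k) * (g : ZMod p) ^ (12 * k) := by rw [hg12]
          _ = (g : ZMod p) ^ (6 * k) * (g : ZMod p) ^ (3 * k) *
              ((g : ZMod p) ^ (4 * k)) ^ 2 := by ring
          _ = _ := by rw [hg6]; ring
      rw [hS (by rw [← pow_mul, show 5 * k * 12 = 12 * k * 5 by ring, pow_mul, hg12, one_pow]),
        h5, sum_range_twelve_mul_pow_twelfth W (by rw [neg_sq, hi])
          (by linear_combination (g : ZMod p) ^ (4 * k) * hu3 + hu) h7 h8 h9 h10 h11] at h
      linear_combination h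
  have hlam : W 0 - W 6 ≡ -1 [ZMOD 4] := classSum_zero_sub_six_modEq hp hg hk0 hk
  have hW2 : Even (W 2 - k) := even_classSum_sub hp hg hk (by norm_num) (by norm_num)
  have hW4 : Even (W 4 - k) := even_classSum_sub hp hg hk (by norm_num) (by norm_num)
  obtain ⟨s, hs⟩ := hW2
  obtain ⟨t, ht⟩ := hW4
  have ha4 : a ≡ -1 [ZMOD 4] := by
    rw [Int.ModEq] at hlam ⊢
    omega
  -- This and `hdb` give c ≡ a and d ≡ b modulo 3, which decide the signs below.
  have hca : c = a + 6 * (s - t) := by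
    have : W 4 = W 2 + 2 * (t - s) := by linarith
    rw [hc, ha, this]; ring
  have hdb : d = b - 3 * (W 1 + W 5) := by rw [hd, hb]; ring
  have hlamac : 3 * (W 0 - W 6) = a + 2 * c := by rw [ha, hc]; ring
  clear_value a b c d
  -- c is odd, and p ≡ 1 mod 4 is not a sum of two odd squares.
  obtain ⟨d', hd'⟩ : ∃ d', d = 2 * d' := by
    rcases Int.even_or_odd' d with ⟨m, hm | hm⟩
    · exact ⟨m, hm⟩
    · exfalso
      obtain ⟨e, he⟩ : ∃ e, c = 2 * e + 1 := by
        refine ⟨(c - 1) / 2, ?_⟩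
        rw [Int.ModEq] at ha4
        omega
      rw [he, hm, hp1] at hcd
      ring_nf at hcd
      omega
  have hxa : x ^ 2 = a ^ 2 := sq_eq_of_prime_eq_sq_add_mul_sq hprime (by norm_num) hxy
    (b := W 1 - W 3 + W 5) (by rw [hab, hb]; ring)
  have hxc : c ^ 2 = a ^ 2 := by
    rw [← hxa, eq_comm]
    exact sq_eq_of_prime_eq_sq_add_mul_sq hprime (by norm_num) hxy (b := d')
      (by rw [hcd, hd']; ring)
  -- Here a ≡ -1 and x ≡ (2/p) = (-1)^k modulo 4.
  have hxa' : a = -((-1) ^ k * x) := by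
    rw [legendreSym_two_eq_neg_one_pow hk0 hk] at hx
    rw [Int.ModEq] at hx ha4
    rcases neg_one_pow_eq_or ℤ k with h | h <;> rw [h] at hx ⊢ <;>
      rcases sq_eq_sq_iff_eq_or_eq_neg.mp hxa with h' | h' <;> omega
  have h3x : 3 ∣ x ↔ 3 ∣ a := by
    rcases sq_eq_sq_iff_eq_or_eq_neg.mp hxa with h' | h' <;> omega
  have hca' := sq_eq_sq_iff_eq_or_eq_neg.mp hxc
  constructor
  · intro h
    rw [h3x] at h
    suffices hcneg : c = -a by
      rw [hlamac, hcneg, hxa']; ring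
    -- When 3 ∣ a the congruence on c says nothing, but 3 ∤ b forces d = b. If also c = a, then a +
    -- bi and a - bi both vanish modulo `p`, so p ∣ 2a, against p = a² + b² with a odd.
    refine hca'.resolve_left fun hceq => ?_
    have hd2 : d ^ 2 = b ^ 2 := by rw [hceq] at hcd; linarith
    have hb3 : ¬ (3 ∣ b) := by
      intro hb3
      obtain ⟨u, hu⟩ := h
      obtain ⟨v, hv⟩ := hb3
      rw [hu, hv, hp1] at hab
      ring_nf at hab
      omega
    have hdeq : d = b := by
      rcases sq_eq_sq_iff_eq_or_eq_neg.mp hd2 with h' | h'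
      · exact h'
      · omega
    have h2a : ((2 * a : ℤ) : ZMod p) = 0 := by
      rw [hceq, hdeq] at hic
      push_cast
      linear_combination hia + hic
    rw [ZMod.intCast_zmod_eq_zero_iff_dvd] at h2a
    have hpa : (p : ℤ) ∣ a := by
      rcases (Nat.prime_iff_prime_int.mp hprime).dvd_or_dvd h2a with h' | h'
      · exfalso
        have := Int.le_of_dvd (by norm_num) h'
        omega
      · exact h'
    obtain ⟨u, hu⟩ := hpa
    have hu0 : u ≠ 0 := by
      rintro rfl
      rw [mul_zero] at hu
      rw [hu] at ha4
      exact absurd ha4 (by decide)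
    have hu1 : 1 ≤ u ^ 2 := by
      have := sq_pos_of_ne_zero hu0
      omega
    have hp13 : (13 : ℤ) ≤ p := by omega
    rw [hu] at hab
    nlinarith [sq_nonneg b, mul_le_mul_of_nonneg_left hu1 (sq_nonneg (p : ℤ))]
  · intro h
    rw [h3x] at h
    -- c = -a would contradict c ≡ a mod 3, as 3 ∤ a.
    have hceq : c = a := by
      rcases hca' with h' | h'
      · exact h'
      · omega
    rw [hceq] at hlamac
    linarith

end Quartic

/-! ### Assembly of the two eigenvalues. -/

theorem theorem1p5 (p : ℕ) [Fact p.Prime] (hp : p ≡ 1 [MOD 6])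
    (x₃ y₃ : ℤ) (hx₃ : x₃ ≡ 1 [ZMOD 3]) (h₃ : (p : ℤ) = x₃ ^ 2 + 3 * y₃ ^ 2) :
    (p ≡ 7 [MOD 12] →
      ∃ z : ℤ, (-3 * (Y p : ℚ)) / (1 + 2 * (x₃ : ℚ)) = (z : ℚ) ^ 2) ∧
    (p ≡ 1 [MOD 12] →
      ∀ x₄ y₄ : ℤ, (p : ℤ) = x₄ ^ 2 + 4 * y₄ ^ 2 → x₄ ≡ legendreSym p 2 [ZMOD 4] →
        ∃ z : ℤ, (-1 : ℚ) ^ ((p + 3) / 4) * 3 * (Y p : ℚ) =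
          (1 + 2 * (x₃ : ℚ)) * (x₄ : ℚ) * deltaSix x₄ * (z : ℚ) ^ 2) := by
  obtain ⟨g, hg⟩ := ZMod.exists_units_orderOf p
  have hprime := (Fact.out : p.Prime)
  have hp2 := hprime.two_le
  rw [Nat.ModEq] at hp
  have hpne : p ≠ 2 := by omega
  obtain ⟨n, hn⟩ : ∃ n, p - 1 = 6 * n := ⟨(p - 1) / 6, by omega⟩
  have hn0 : n ≠ 0 := by omega
  obtain ⟨z, hz⟩ := exists_Y_eq hpne hg hn0 hn
  have hlam := three_mul_sum_shiftedChar_six_mul hpne hg hn0 hn hx₃ h₃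
  constructor
  · intro h7
    rw [Nat.ModEq] at h7
    refine ⟨z, ?_⟩
    rw [if_neg (by rw [Nat.even_iff]; omega), mul_one] at hz
    have hne : (1 + 2 * (x₃ : ℚ)) ≠ 0 := by
      have : (1 + 2 * x₃ : ℤ) ≠ 0 := by omega
      exact_mod_cast this
    have h3Y : -3 * Y p = (1 + 2 * x₃) * z ^ 2 := by
      rw [hz]; linear_combination -z ^ 2 * hlam
    rw [div_eq_iff hne]
    have := congrArg (Int.cast : ℤ → ℚ) h3Y
    push_cast at this
    linear_combination this
  · intro h1 x₄ y₄ h₄ hx₄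
    rw [Nat.ModEq] at h1
    refine ⟨z, ?_⟩
    obtain ⟨k, hk⟩ : ∃ k, p - 1 = 12 * k := ⟨(p - 1) / 12, by omega⟩
    obtain rfl : n = 2 * k := by omega
    have hk0 : k ≠ 0 := by omega
    rw [if_pos (even_two_mul k), sum_shiftedChar_six_mul_neg_one_pow] at hz
    obtain ⟨hdvd, hndvd⟩ := classSum_zero_sub_six_eq hg hk0 hk hx₄ h₄
    set μ := classSum g k 0 - classSum g k 6
    have h3Y : 3 * Y p = -(1 + 2 * x₃) * μ * z ^ 2 := by
      rw [hz]; linear_combination μ * z ^ 2 * hlam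
    have h3Y' : 3 * (Y p : ℚ) = -(1 + 2 * x₃) * μ * z ^ 2 := by exact_mod_cast h3Y
    have hsign : ((-1 : ℚ) ^ k) * (-1) ^ k = 1 := by rw [← mul_pow]; simp
    -- p = 12k + 1 gives (p + 3)/4 = 3k + 1.
    have hexp : (-1 : ℚ) ^ ((p + 3) / 4) = -(-1) ^ k := by
      rw [show (p + 3) / 4 = 2 * k + k + 1 by omega, pow_succ, pow_add, pow_mul]
      norm_num
    rw [hexp, mul_assoc, h3Y', deltaSix]
    split_ifs with h3
    · have hμ : 3 * (μ : ℚ) = (-1) ^ k * x₄ := by exact_mod_cast hdvd h3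
      linear_combination (1 + 2 * (x₃ : ℚ)) * z ^ 2 / 3 * ((-1) ^ k * hμ + x₄ * hsign)
    · have hμ : (μ : ℚ) = -((-1) ^ k * x₄) := by exact_mod_cast hndvd h3
      linear_combination (1 + 2 * (x₃ : ℚ)) * z ^ 2 * ((-1) ^ k * hμ - x₄ * hsign)
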